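/- **Theorem.** Let $\mathbb{K}$ be an algebraically closed field with a non-trivial valuation $v:\mathbb{K}^*\to\mathbb{R}$ (real-valued, i.e. of rank one), let $\mathbb{T}=v(\mathbb{K}^*)\subseteq\mathbb{R}$ be its value group, and let $T$ denote the map $x\mapsto -v(x)$ from $\mathbb{K}^*$ to $\mathbb{T}$, applied coordinatewise to tuples. A *support* is a nonempty finite subset of $\mathbb{Z}^2$ up to translation by an integer vector. Let $G=(\mathfrak{p},\mathfrak{B},\mathfrak{I},\mathrm{Sup})$ be a finite incidence structure: disjoint finite sets $\mathfrak{p}$ (points) and $\mathfrak{B}$ (curves), a set $\mathfrak{I}\subseteq\mathfrak{p}\times\mathfrak{B}$ of incidence relations, and a map $\mathrm{Sup}$ assigning a support to each $y\in\mathfrak{B}$. Its incidence graph is the bipartite graph with vertex set $\mathfrak{p}\cup\mathfrak{B}$ and edge set $\mathfrak{I}$. For each $y\in\mathfrak{B}$ choose a finite set $I_y\subset\mathbb{Z}^2$ representing $\mathrm{Sup}(y)$ and an index $o_y\in I_y$, and put $\delta_y=\#I_y$. Let $$S_G=\prod_{x\in\mathfrak{p}}(\mathbb{K}^*)^2\times\prod_{y\in\mathfrak{B}}(\mathbb{K}^*)^{\delta_y-1},\qquad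 S_G^t=\prod_{x\in\mathfrak{p}}\mathbb{T}^2\times\prod_{y\in\mathfrak{B}}\mathbb{T}^{\delta_y-1},$$ where the factor of $y$ in $S_G$ consists of the tuples $(a_i)_{i\in I_y\setminus\{o_y\}}$ and represents, with $a_{o_y}=1$, the curve $\{(z,w)\in(\mathbb{K}^*)^2:\sum_{i\in I_y}a_i z^{i_1}w^{i_2}=0\}$; and the factor of $y$ in $S_G^t$ consists of the tuples $(a_i)_{i\in I_y\setminus\{o_y\}}$ and represents, with $a_{o_y}=0$, the tropical curve of those $(z,w)\in\mathbb{T}^2$ for which $\max_{i\in I_y}(a_i+i_1z+i_2w)$ is attained for at least two different indices $i\in I_y$. An algebraic (resp. tropical) realization of $G$ is an element of $S_G$ (resp. $S_G^t$) such that, for every $(x,y)\in\mathfrak{I}$, the point at $x$ lies on the curve (resp. tropical curve) represented at $y$. Let $R_G\subseteq S_G$ and $R_G^t\subseteq S_G^t$ be the sets of algebraic and of tropical realizations. If the incidence graph of $G$ is acyclic, then $$T(R_G)=R_G^t .$$ In particular, every tropical realization $x$ of $G$ lifts to an algebraic realization $\widetilde{x}$ of $G$ with $T(\widetilde{x})=x$.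 -/

import Mathlib

namespace TropicalIncidence

noncomputable section

/-! ### Valued fields and the tropicalization map -/

section Valuation

variable {K : Type*} [Field K]

/-- The real number `v x` for a nonzero `x`. -/
def val (v : AddValuation K (WithTop ℝ)) (x : Kˣ) : ℝ :=
  (v (x : K)).untop (fun h => x.ne_zero (v.top_iff.1 h))

theorem coe_val (v : AddValuation K (WithTop ℝ)) (x : Kˣ) :
    ((val v x : ℝ) : WithTop ℝ) = v (x : K) :=
  WithTop.coe_untop _ _

theorem val_one (v : AddValuation K (WithTop ℝ)) : val v 1 = 0 := by
  have h : ((val v 1 : ℝ) : WithTop ℝ) = ((0 : ℝ) : WithTop ℝ) := by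
    rw [coe_val]; simp
  exact_mod_cast h

theorem val_mul (v : AddValuation K (WithTop ℝ)) (x y : Kˣ) :
    val v (x * y) = val v x + val v y := by
  have h : ((val v (x * y) : ℝ) : WithTop ℝ) = ((val v x + val v y : ℝ) : WithTop ℝ) := by
    rw [coe_val, WithTop.coe_add, coe_val, coe_val]; simp
  exact_mod_cast h

theorem val_inv (v : AddValuation K (WithTop ℝ)) (x : Kˣ) : val v x⁻¹ = -val v x := by
  have h := val_mul v x x⁻¹
  rw [mul_inv_cancel, val_one] at h
  linarith

/-- The value group `𝕋 = v(K*) ⊆ ℝ`, with the order and the addition of `ℝ`. -/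
def valueGroup (v : AddValuation K (WithTop ℝ)) : AddSubgroup ℝ where
  carrier := Set.range (val v)
  zero_mem' := ⟨1, val_one v⟩
  add_mem' := by
    rintro _ _ ⟨x, rfl⟩ ⟨y, rfl⟩
    exact ⟨x * y, val_mul v x y⟩
  neg_mem' := by
    rintro _ ⟨x, rfl⟩
    exact ⟨x⁻¹, val_inv v x⟩

/-- Tropicalization of one coordinate: `K* → 𝕋`, `x ↦ -v(x)`. -/
def trop (v : AddValuation K (WithTop ℝ)) (x : Kˣ) : valueGroup v :=
  ⟨-val v x, (valueGroup v).neg_mem ⟨x, rfl⟩⟩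

end Valuation

/-! ### Curves of fixed support in the plane torus -/

/-- The zero set in `(K*)²` of the Laurent polynomial `∑_{i ∈ I} a_i x^{i₁} y^{i₂}`. -/
def algCurve {K : Type*} [Field K] (I : Finset (ℤ × ℤ)) (a : {i // i ∈ I} → Kˣ) :
    Set (Kˣ × Kˣ) :=
  {p | ∑ i : {i // i ∈ I}, (a i : K) * (p.1 : K) ^ i.1.1 * (p.2 : K) ^ i.1.2 = 0}

/-- The value at `p` of the tropical monomial `"a_i x^{i₁} y^{i₂}"`. -/
def tropMonomial {T : Type*} [AddCommGroup T] {I : Finset (ℤ × ℤ)} (a : {i // i ∈ I} → T)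
    (p : T × T) (i : {i // i ∈ I}) : T :=
  a i + (i.1.1 • p.1 + i.1.2 • p.2)

/-- The tropical curve of `"∑_{i ∈ I} a_i x^{i₁} y^{i₂}"`: the points at which the maximum of the
monomials is attained at two different indices. -/
def tropCurve {T : Type*} [AddCommGroup T] [LE T] (I : Finset (ℤ × ℤ))
    (a : {i // i ∈ I} → T) : Set (T × T) :=
  {p | ∃ i j, i ≠ j ∧ tropMonomial a p i = tropMonomial a p j ∧
    ∀ k, tropMonomial a p k ≤ tropMonomial a p i}

/-! ### Incidence structures -/

/-- Two finite subsets of `ℤ²` are equivalent if one is an integer translate of the other. -/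
def supportSetoid : Setoid {A : Finset (ℤ × ℤ) // A.Nonempty} where
  r A B := ∃ w : ℤ × ℤ, (A : Set (ℤ × ℤ)) = (fun b => w + b) '' (B : Set (ℤ × ℤ))
  iseqv :=
    { refl := fun A => ⟨0, by simp⟩
      symm := by
        rintro A B ⟨w, h⟩
        refine ⟨-w, ?_⟩
        rw [h, Set.image_image]
        simp
      trans := by
        rintro A B C ⟨w, h⟩ ⟨w', h'⟩
        refine ⟨w + w', ?_⟩
        rw [h, h', Set.image_image]
        simp [add_assoc] }

/-- A support: a nonempty finite subset of `ℤ²` up to integer translation. -/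
def Support : Type := Quotient supportSetoid

/-- An incidence structure with points `P` and blocks (curves) `B`. -/
structure IncidenceStructure (P B : Type*) where
  /-- the incidence relations -/
  flags : Set (P × B)
  /-- the support of each curve -/
  sup : B → Support

namespace IncidenceStructure

variable {P B : Type*}

/-- The Levi (incidence) graph: bipartite, with vertices `P ⊔ B` and edges the flags. -/
def leviGraph (G : IncidenceStructure P B) : SimpleGraph (P ⊕ B) :=
  SimpleGraph.fromRel fun u w => ∃ x y, u = Sum.inl x ∧ w = Sum.inr y ∧ (x, y) ∈ G.flags

/-- A choice of coordinates on the spaces of curves: for each block a finite set of exponents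
representing its support, and the monomial by which equations are dehomogenized (its coefficient
is normalized to be the unit). -/
structure Dehomogenization (G : IncidenceStructure P B) where
  exps : B → {A : Finset (ℤ × ℤ) // A.Nonempty}
  exps_spec : ∀ y, Quotient.mk supportSetoid (exps y) = G.sup y
  base : ∀ y, {i // i ∈ (exps y).1}

namespace Dehomogenization

variable {G : IncidenceStructure P B}

/-- The support space `∏_{x ∈ P} A² × ∏_{y ∈ B} A^{δ_y - 1}`; it is `S_G` for `A = K*` and
`S_G^t` for `A = 𝕋`. -/
def Space (D : G.Dehomogenization) (A : Type*) : Type _ :=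
  (P → A × A) × (∀ y : B, {i : {i // i ∈ (D.exps y).1} // i ≠ D.base y} → A)

/-- All coefficients of the dehomogenized equation of a curve with support `G.sup y`; `u` is the
unit: `1` algebraically and `0` tropically. -/
def coeffs (D : G.Dehomogenization) {A : Type*} (u : A) (y : B)
    (c : {i : {i // i ∈ (D.exps y).1} // i ≠ D.base y} → A) : {i // i ∈ (D.exps y).1} → A :=
  open Classical in fun i => if h : i = D.base y then u else c ⟨i, h⟩

/-- `R_G ⊆ S_G`, the algebraic realizations of `G`. -/
def algRealizations (D : G.Dehomogenization) (K : Type*) [Field K] : Set (D.Space Kˣ) :=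
  {s | ∀ x y, (x, y) ∈ G.flags → s.1 x ∈ algCurve (D.exps y).1 (D.coeffs 1 y (s.2 y))}

/-- `R_G^t ⊆ S_G^t`, the tropical realizations of `G`. -/
def tropRealizations (D : G.Dehomogenization) (T : Type*) [AddCommGroup T] [LE T] :
    Set (D.Space T) :=
  {s | ∀ x y, (x, y) ∈ G.flags → s.1 x ∈ tropCurve (D.exps y).1 (D.coeffs 0 y (s.2 y))}

/-- The tropicalization map `S_G → S_G^t`, coordinatewise `x ↦ -v(x)`. -/
def tropicalization {K : Type*} [Field K] (v : AddValuation K (WithTop ℝ))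
    (D : G.Dehomogenization) (s : D.Space Kˣ) : D.Space (valueGroup v) :=
  (fun x => (trop v (s.1 x).1, trop v (s.1 x).2), fun y i => trop v (s.2 y i))

end Dehomogenization

end IncidenceStructure

end

end TropicalIncidence

/-!
A zero of a sum of units attains its minimal valuation at two different terms, so the coordinatewise
tropicalization of an algebraic realization is a tropical realization
(`exists_ne_val_eq_of_sum_eq_zero`).

For the converse, a tropical realization is lifted one vertex of the incidence graph at a time.
Since the graph is a finite forest, its vertices can be ordered so that each has at most one
neighbour among its predecessors (`exists_forall_adj_of_isAcyclic`). Thus only two one-step lifting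
problems arise.

* A curve has to be lifted through one given point (`exists_lift_curve`). Multiplying the
  coefficients by the values of the monomials at the point turns this into the choice of terms of
  prescribed valuations, one of which is given, with sum zero (`exists_lift_sum_eq_zero`). One
  maximal term is determined by the others; its valuation is right as soon as the others do not
  cancel, which can be arranged because the residue field has an element other than `0` and `-1`.

* A point has to be lifted to one given curve (`exists_lift_point`). Restricting the equation to a
  one-parameter curve on which the exponents stay distinct reduces this to the following fact
  about polynomials in one variable: if the minimal valuation of the coefficients is attained twice,
  there is a root of valuation `0` (`exists_isRoot_val_eq_zero`). Indeed, a product of a constant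
  and linear factors `X - r` with `v r ≠ 0` has a single coefficient of minimal valuation, by
  induction on the number of factors.
-/

namespace TropicalIncidence

/-! ### Lifting along a forest -/

/-- A finite nonempty forest has a vertex with at most one neighbour. -/
theorem exists_subsingleton_neighborSet_of_isAcyclic {V : Type*} [Finite V] [Nonempty V]
    {G : SimpleGraph V} (hG : G.IsAcyclic) : ∃ w, (G.neighborSet w).Subsingleton := by
  classical
  let c : G.ConnectedComponent := G.connectedComponentMk (Classical.arbitrary V)
  have hc := hG.isTree_connectedComponent c
  have := Fintype.ofFinite c
  rcases subsingleton_or_nontrivial c with h | h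
  · refine ⟨Classical.arbitrary V, fun a ha b hb => ?_⟩
    have hs : ∀ a, G.Adj (Classical.arbitrary V) a → a = Classical.arbitrary V := fun a ha =>
      congrArg Subtype.val (Subsingleton.elim (⟨a, SimpleGraph.ConnectedComponent.sound
        ha.reachable.symm⟩ : c) ⟨Classical.arbitrary V, rfl⟩)
    rw [hs a ha, hs b hb]
  · obtain ⟨w, hw⟩ := hc.exists_vert_degree_one_of_nontrivial
    obtain ⟨u, -, hu⟩ := SimpleGraph.degree_eq_one_iff_existsUnique_adj.1 hw
    have hs : ∀ a, G.Adj w a → a = u := fun a ha =>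
      congrArg Subtype.val (hu ⟨a, (SimpleGraph.ConnectedComponent.sound
        ha.reachable.symm).trans w.2⟩ ha)
    exact ⟨w, fun a ha b hb => (hs a ha).trans (hs b hb).symm⟩

/-- Suppose that a symmetric relation between the values at two vertices can always be solved
along an edge of a finite forest, whatever the value at one end. Then values can be chosen at all
vertices so that the relation holds along every edge. -/
theorem exists_forall_adj_of_isAcyclic {V : Type*} [Finite V] {G : SimpleGraph V}
    (hG : G.IsAcyclic) {X : V → Type*} [∀ u, Nonempty (X u)] (R : ∀ u w, X u → X w → Prop)
    (hsymm : ∀ u w a b, R u w a b → R w u b a)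
    (hext : ∀ u w, G.Adj u w → ∀ a, ∃ b, R u w a b) :
    ∃ f : ∀ u, X u, ∀ u w, G.Adj u w → R u w (f u) (f w) := by
  classical
  suffices H : ∀ s : Finset V, ∃ f : ∀ u, X u, ∀ u ∈ s, ∀ w ∈ s, G.Adj u w → R u w (f u) (f w) by
    have := Fintype.ofFinite V
    obtain ⟨f, hf⟩ := H Finset.univ
    exact ⟨f, fun u w h => hf u (Finset.mem_univ _) w (Finset.mem_univ _) h⟩
  intro s
  induction s using Finset.strongInduction with
  | H s ih =>
    rcases s.eq_empty_or_nonempty with rfl | hs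
    · exact ⟨fun u => Classical.arbitrary _, by simp⟩
    have : Nonempty (s : Set V) := hs.to_subtype
    obtain ⟨⟨w, hw⟩, hsub⟩ := exists_subsingleton_neighborSet_of_isAcyclic (hG.induce (s : Set V))
    have huniq : ∀ a ∈ s, ∀ b ∈ s, G.Adj w a → G.Adj w b → a = b := fun a ha b hb hwa hwb =>
      congrArg Subtype.val (hsub (show (⟨a, ha⟩ : (s : Set V)) ∈ _ from hwa)
        (show (⟨b, hb⟩ : (s : Set V)) ∈ _ from hwb))
    obtain ⟨f, hf⟩ := ih (s.erase w) (Finset.erase_ssubset hw)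
    obtain ⟨b, hb⟩ : ∃ b : X w, ∀ u ∈ s, G.Adj u w → R u w (f u) b := by
      by_cases h : ∃ u ∈ s, G.Adj u w
      · obtain ⟨u, hu, huw⟩ := h
        obtain ⟨b, hb⟩ := hext u w huw (f u)
        refine ⟨b, fun u' hu' hu'w => ?_⟩
        obtain rfl := huniq u hu u' hu' huw.symm hu'w.symm
        exact hb
      · exact ⟨Classical.arbitrary _, fun u hu huw => absurd ⟨u, hu, huw⟩ h⟩
    refine ⟨Function.update f w b, fun u hu u' hu' h => ?_⟩
    rcases eq_or_ne u w with rfl | huw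
    · rw [Function.update_self, Function.update_of_ne h.ne']
      exact hsymm _ _ _ _ (hb u' hu' h.symm)
    · rcases eq_or_ne u' w with rfl | hu'w
      · rw [Function.update_self, Function.update_of_ne huw]
        exact hb u hu h
      · rw [Function.update_of_ne huw, Function.update_of_ne hu'w]
        exact hf u (Finset.mem_erase.2 ⟨huw, hu⟩) u' (Finset.mem_erase.2 ⟨hu'w, hu'⟩) h

/-! ### Valuations of sums -/

section Sums

variable {K : Type*} [Field K] (v : AddValuation K (WithTop ℝ))

/-- If a sum of units vanishes, the minimal valuation of its terms is attained twice. -/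
theorem exists_ne_val_eq_of_sum_eq_zero {ι : Type*} [Fintype ι] [Nonempty ι] (t : ι → Kˣ)
    (h : ∑ k, (t k : K) = 0) :
    ∃ i j, i ≠ j ∧ v (t i) = v (t j) ∧ ∀ k, v (t i : K) ≤ v (t k) := by
  classical
  obtain ⟨i, hi⟩ := Finite.exists_min fun k => v (t k : K)
  by_contra! hne
  have hlt : v (t i : K) < v (∑ k ∈ Finset.univ.erase i, (t k : K)) := by
    refine v.map_lt_sum (v.ne_top_iff.2 (t i).ne_zero) fun k hk => ?_
    refine lt_of_le_of_ne (hi k) fun hik => ?_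
    obtain ⟨l, hl⟩ := hne i k (Finset.ne_of_mem_erase hk).symm hik
    exact absurd (hi l) (not_le.2 hl)
  rw [← Finset.add_sum_erase _ _ (Finset.mem_univ i)] at h
  rw [eq_neg_of_add_eq_zero_right h, v.map_neg] at hlt
  exact lt_irrefl _ hlt

/-- The residue field of an algebraically closed valued field has an element other than `0` and
`-1`. A root of `X ^ 2 + X + 1` lifts such an element. -/
theorem exists_val_eq_zero_val_add_one_eq_zero [IsAlgClosed K] :
    ∃ c : K, v c = 0 ∧ v (c + 1) = 0 := by
  obtain ⟨c, hc⟩ : ∃ c : K, c * (c + 1) = -1 := by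
    have hdeg : (Polynomial.X ^ 2 + Polynomial.X + 1 : Polynomial K).degree = 2 := by
      compute_degree!
    obtain ⟨c, hc⟩ := IsAlgClosed.exists_root _ (hdeg.trans_ne two_ne_zero)
    refine ⟨c, ?_⟩
    simp only [Polynomial.IsRoot.def, Polynomial.eval_add, Polynomial.eval_pow,
      Polynomial.eval_X, Polynomial.eval_one] at hc
    linear_combination hc
  have hv : v c + v (c + 1) = 0 := by
    rw [← v.map_mul, hc, v.map_neg, v.map_one]
  rcases lt_trichotomy (v c) 0 with h | h | h
  · -- Here `v (c + 1) = v c`, so both are negative and their sum is not `0`.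
    have h1 : v (c + 1) = v c := v.map_add_eq_of_lt_left (by rwa [v.map_one])
    rw [h1] at hv
    obtain ⟨s, hs⟩ := WithTop.ne_top_iff_exists.1 (h.trans_le le_top).ne
    rw [← hs] at h hv
    norm_cast at h hv
    linarith
  · exact ⟨c, h, by rwa [h, zero_add] at hv⟩
  · have h1 : v (c + 1) = v 1 := v.map_add_eq_of_lt_right (by rwa [v.map_one])
    rw [h1, v.map_one, add_zero] at hv
    exact absurd hv h.ne'

/-- If `v z ≤ v S`, some `c` has the same valuation as `z` and does not cancel `S` to a higher
valuation. -/
theorem exists_val_add_eq [IsAlgClosed K] (z : Kˣ) (S : K) (h : v (z : K) ≤ v S) :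
    ∃ c : Kˣ, v (c : K) = v (z : K) ∧ v (S + c) = v (z : K) := by
  rcases h.lt_or_eq with h | h
  · exact ⟨z, rfl, v.map_add_eq_of_lt_right h⟩
  · obtain ⟨u, hu, hu1⟩ := exists_val_eq_zero_val_add_one_eq_zero v
    have hS : S ≠ 0 := v.ne_top_iff.1 (h ▸ v.ne_top_iff.2 z.ne_zero)
    have hu0 : u ≠ 0 := v.ne_top_iff.1 (by simp [hu])
    refine ⟨Units.mk0 (S * u) (mul_ne_zero hS hu0), by simp [hu, h], ?_⟩
    rw [Units.val_mk0, show S + S * u = S * (u + 1) by ring, v.map_mul, hu1, add_zero, h]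

end Sums

/-! ### Roots of valuation zero -/

section Roots

open Polynomial

variable {K : Type*} [Field K] (v : AddValuation K (WithTop ℝ))

/-- Multiplication by `X - r` with `v r ≠ 0` preserves the property that the minimal valuation of
the coefficients is attained only once: the dominant monomial moves up by one degree if
`0 < v r`, and stays in place if `v r < 0`. -/
theorem exists_dominant_coeff_X_sub_C_mul {f : K[X]} {r : K} (hr : v r ≠ 0)
    (hf : ∃ n, ∀ k ≠ n, v (f.coeff n) < v (f.coeff k)) :
    ∃ n, ∀ k ≠ n, v (((X - C r) * f).coeff n) < v (((X - C r) * f).coeff k) := by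
  obtain ⟨n, hn⟩ := hf
  have hle : ∀ k, v (f.coeff n) ≤ v (f.coeff k) := fun k => by
    rcases eq_or_ne k n with rfl | h
    exacts [le_rfl, (hn k h).le]
  have htop : v (f.coeff n) ≠ ⊤ := ((hn (n + 1) (by omega)).trans_le le_top).ne
  obtain ⟨m, hm⟩ := WithTop.ne_top_iff_exists.1 htop
  have hcoeff : ∀ k, ((X - C r) * f).coeff (k + 1) = f.coeff k - r * f.coeff (k + 1) := fun k => by
    rw [sub_mul, coeff_sub, coeff_X_mul, coeff_C_mul]
  have hcoeff0 : ((X - C r) * f).coeff 0 = -(r * f.coeff 0) := by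
    rw [sub_mul, coeff_sub, coeff_X_mul_zero, coeff_C_mul, zero_sub]
  rcases hr.lt_or_gt with h | h
  · obtain ⟨s, hs⟩ := WithTop.ne_top_iff_exists.1 (h.trans_le le_top).ne
    have hlt : v (r * f.coeff n) < v (f.coeff n) := by
      simpa using WithTop.add_lt_add_right htop h
    have hlt' : ∀ k ≠ n, v (r * f.coeff n) < v (r * f.coeff k) := fun k hk => by
      rw [v.map_mul, v.map_mul]
      exact WithTop.add_lt_add_left (h.trans_le le_top).ne (hn k hk)
    have hval : v (((X - C r) * f).coeff n) = v (r * f.coeff n) := by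
      cases n with
      | zero => rw [hcoeff0, v.map_neg]
      | succ n =>
        rw [hcoeff]
        exact v.map_sub_eq_of_lt_right (hlt.trans_le (hle n))
    refine ⟨n, fun k hk => ?_⟩
    rw [hval]
    cases k with
    | zero => rw [hcoeff0, v.map_neg]; exact hlt' 0 hk
    | succ k =>
      rw [hcoeff]
      exact (lt_min (hlt.trans_le (hle k)) (hlt' _ hk)).trans_le (v.map_sub _ _)
  · have hlt : ∀ k, v (f.coeff n) < v (r * f.coeff k) := fun k => by
      rw [v.map_mul]
      refine lt_of_lt_of_le ?_ (add_le_add_right (hle k) (v r))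
      simpa using WithTop.add_lt_add_right htop h
    refine ⟨n + 1, fun k hk => ?_⟩
    rw [hcoeff, v.map_sub_eq_of_lt_left (hlt _)]
    cases k with
    | zero => rw [hcoeff0, v.map_neg]; exact hlt 0
    | succ k =>
      rw [hcoeff]
      exact (lt_min (hn k (by omega)) (hlt _)).trans_le (v.map_sub _ _)

/-- If the minimal valuation of the coefficients of a nonzero polynomial is attained twice, the
polynomial has a root of valuation `0`. -/
theorem exists_isRoot_val_eq_zero [IsAlgClosed K] {f : K[X]} {i j : ℕ} (hij : i ≠ j)
    (hne : f.coeff i ≠ 0) (heq : v (f.coeff i) = v (f.coeff j))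
    (hle : ∀ k, v (f.coeff i) ≤ v (f.coeff k)) : ∃ r, f.IsRoot r ∧ v r = 0 := by
  by_contra! hroot
  have hf : f ≠ 0 := by rintro rfl; simp at hne
  have key : ∀ s : Multiset K, (∀ r ∈ s, v r ≠ 0) →
      ∃ n, ∀ k ≠ n, v ((C f.leadingCoeff * (s.map fun r => X - C r).prod).coeff n) <
        v ((C f.leadingCoeff * (s.map fun r => X - C r).prod).coeff k) := by
    intro s
    induction s using Multiset.induction with
    | empty =>
      refine fun _ => ⟨0, fun k hk => ?_⟩
      have : v f.leadingCoeff < ⊤ := lt_top_iff_ne_top.2 (v.ne_top_iff.2 (leadingCoeff_ne_zero.2 hf))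
      simpa [coeff_C, hk] using this
    | cons r s ih =>
      intro hs
      rw [Multiset.map_cons, Multiset.prod_cons, mul_left_comm]
      exact exists_dominant_coeff_X_sub_C_mul v (hs r (Multiset.mem_cons_self r s))
        (ih fun r' hr' => hs r' (Multiset.mem_cons_of_mem hr'))
  obtain ⟨n, hn⟩ := key f.roots fun r hr => hroot r (isRoot_of_mem_roots hr)
  rw [← (IsAlgClosed.splits f).eq_prod_roots] at hn
  rcases eq_or_ne i n with rfl | hin
  · exact (hn j hij.symm).ne heq
  · exact not_lt.2 (hle n) (hn i hin)

end Roots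

/-! ### Tropicalization of monomials -/

section Trop

variable {K : Type*} [Field K] (v : AddValuation K (WithTop ℝ))

theorem trop_le_trop_iff {x y : Kˣ} : trop v x ≤ trop v y ↔ v (y : K) ≤ v (x : K) := by
  rw [← coe_val, ← coe_val, WithTop.coe_le_coe]
  exact neg_le_neg_iff (a := val v x)

theorem trop_eq_trop_iff {x y : Kˣ} : trop v x = trop v y ↔ v (x : K) = v (y : K) := by
  rw [le_antisymm_iff, le_antisymm_iff, trop_le_trop_iff, trop_le_trop_iff, and_comm]

theorem trop_one : trop v 1 = 0 :=
  Subtype.ext (by simp [trop, val_one])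

theorem trop_mul (x y : Kˣ) : trop v (x * y) = trop v x + trop v y :=
  Subtype.ext (by simp only [trop, val_mul, AddSubgroup.coe_add]; ring)

theorem trop_zpow (x : Kˣ) (n : ℤ) : trop v (x ^ n) = n • trop v x := by
  let φ : Kˣ →* Multiplicative (valueGroup v) :=
    { toFun := fun x => Multiplicative.ofAdd (trop v x)
      map_one' := congrArg Multiplicative.ofAdd (trop_one v)
      map_mul' := fun x y => congrArg Multiplicative.ofAdd (trop_mul v x y) }
  exact congrArg Multiplicative.toAdd (map_zpow φ x n)

theorem trop_surjective : Function.Surjective (trop v) := by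
  rintro ⟨_, x, rfl⟩
  exact ⟨x⁻¹, Subtype.ext (by simp [trop, val_inv])⟩

theorem trop_eq_zero_of_val_eq_zero {x : Kˣ} (h : v (x : K) = 0) : trop v x = 0 := by
  rw [← trop_one v, trop_eq_trop_iff, h, Units.val_one, v.map_one]

/-- The value at `p` of the monomial `a_i x^{i₁} y^{i₂}`, as a unit. -/
def algMonomial {I : Finset (ℤ × ℤ)} (a : {i // i ∈ I} → Kˣ) (p : Kˣ × Kˣ)
    (i : {i // i ∈ I}) : Kˣ :=
  a i * (p.1 ^ i.1.1 * p.2 ^ i.1.2)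

theorem mem_algCurve_iff {I : Finset (ℤ × ℤ)} {a : {i // i ∈ I} → Kˣ} {p : Kˣ × Kˣ} :
    p ∈ algCurve I a ↔ ∑ i, (algMonomial a p i : K) = 0 := by
  simp [algCurve, algMonomial, mul_assoc]

theorem trop_algMonomial {I : Finset (ℤ × ℤ)} (a : {i // i ∈ I} → Kˣ) (p : Kˣ × Kˣ)
    (i : {i // i ∈ I}) :
    trop v (algMonomial a p i) =
      tropMonomial (fun k => trop v (a k)) (trop v p.1, trop v p.2) i := by
  simp only [algMonomial, tropMonomial, trop_mul, trop_zpow]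

theorem trop_mem_tropCurve {I : Finset (ℤ × ℤ)} (hI : I.Nonempty) {a : {i // i ∈ I} → Kˣ}
    {p : Kˣ × Kˣ} (hp : p ∈ algCurve I a) :
    (trop v p.1, trop v p.2) ∈ tropCurve I fun k => trop v (a k) := by
  have := hI.to_subtype
  obtain ⟨i, j, hij, heq, hle⟩ := exists_ne_val_eq_of_sum_eq_zero v _ (mem_algCurve_iff.1 hp)
  refine ⟨i, j, hij, ?_, fun k => ?_⟩
  · rw [← trop_algMonomial, ← trop_algMonomial, trop_eq_trop_iff, heq]
  · rw [← trop_algMonomial, ← trop_algMonomial, trop_le_trop_iff]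
    exact hle k

theorem trop_coeffs {P B : Type*} {G : IncidenceStructure P B} (D : G.Dehomogenization) (y : B)
    (c : {i : {i // i ∈ (D.exps y).1} // i ≠ D.base y} → Kˣ) :
    (fun k => trop v (D.coeffs 1 y c k)) = D.coeffs 0 y fun k => trop v (c k) := by
  funext k
  by_cases h : k = D.base y <;> simp [IncidenceStructure.Dehomogenization.coeffs, h, trop_one]

end Trop

/-! ### Lifting a curve through a given point -/

section LiftCurve

variable {K : Type*} [Field K] [IsAlgClosed K] (v : AddValuation K (WithTop ℝ))

/-- If the maximum of prescribed tropical values `τ` is attained twice, they lift to units whose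
sum is zero, and the lift of one of them can be prescribed. -/
theorem exists_lift_sum_eq_zero {ι : Type*} [Fintype ι] (τ : ι → valueGroup v) {o : ι} {z : Kˣ}
    (hz : trop v z = τ o) (hτ : ∃ i j, i ≠ j ∧ τ i = τ j ∧ ∀ k, τ k ≤ τ i) :
    ∃ t : ι → Kˣ, t o = z ∧ (∀ k, trop v (t k) = τ k) ∧ ∑ k, (t k : K) = 0 := by
  classical
  obtain ⟨j, hjo, i, hij, heq, hle⟩ : ∃ j, j ≠ o ∧ ∃ i, i ≠ j ∧ τ i = τ j ∧ ∀ k, τ k ≤ τ j := by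
    obtain ⟨i, j, hij, heq, hle⟩ := hτ
    by_cases hj : j = o
    · exact ⟨i, hj ▸ hij, j, hij.symm, heq.symm, hle⟩
    · exact ⟨j, hj, i, hij, heq, heq ▸ hle⟩
  -- It suffices that the terms other than the `j`-th have a sum of the valuation required of
  -- the `j`-th.
  suffices H : ∃ t : ι → Kˣ, t o = z ∧ (∀ k, trop v (t k) = τ k) ∧
      v (∑ k ∈ Finset.univ.erase j, (t k : K)) = v (t j : K) by
    obtain ⟨t, hto, ht, hv⟩ := H
    have h0 : -∑ k ∈ Finset.univ.erase j, (t k : K) ≠ 0 :=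
      neg_ne_zero.2 (v.ne_top_iff.1 (hv ▸ v.ne_top_iff.2 (t j).ne_zero))
    refine ⟨Function.update t j (Units.mk0 _ h0), ?_, fun k => ?_, ?_⟩
    · rw [Function.update_of_ne hjo.symm, hto]
    · rcases eq_or_ne k j with rfl | hk
      · rw [Function.update_self, ← ht k, trop_eq_trop_iff, Units.val_mk0, v.map_neg, hv]
      · rw [Function.update_of_ne hk, ht]
    · rw [← Finset.add_sum_erase _ _ (Finset.mem_univ j), Function.update_self, Units.val_mk0,
        neg_add_eq_zero]
      exact Finset.sum_congr rfl fun k hk => by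
        rw [Function.update_of_ne (Finset.ne_of_mem_erase hk)]
  obtain ⟨t, hto, ht⟩ : ∃ t : ι → Kˣ, t o = z ∧ ∀ k, trop v (t k) = τ k := by
    choose t ht using fun k => trop_surjective v (τ k)
    refine ⟨Function.update t o z, Function.update_self _ _ _, fun k => ?_⟩
    rcases eq_or_ne k o with rfl | hk
    · rw [Function.update_self, hz]
    · rw [Function.update_of_ne hk, ht]
  have htle : ∀ k, v (t j : K) ≤ v (t k : K) := fun k => by
    rw [← trop_le_trop_iff, ht, ht]
    exact hle k
  by_cases hi : ∃ i, i ≠ o ∧ i ≠ j ∧ τ i = τ j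
  · -- A free maximal term can be chosen so as not to cancel the others.
    obtain ⟨i, hio, hij, heq⟩ := hi
    have hmem : i ∈ Finset.univ.erase j := Finset.mem_erase.2 ⟨hij, Finset.mem_univ i⟩
    obtain ⟨c, hc, hSc⟩ := exists_val_add_eq v (t j)
      (∑ k ∈ (Finset.univ.erase j).erase i, (t k : K)) (v.map_le_sum fun k _ => htle k)
    refine ⟨Function.update t i c, ?_, fun k => ?_, ?_⟩
    · rw [Function.update_of_ne hio.symm, hto]
    · rcases eq_or_ne k i with rfl | hk
      · rw [Function.update_self, heq, ← ht j, trop_eq_trop_iff, hc]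
      · rw [Function.update_of_ne hk, ht]
    · rw [← Finset.sum_erase_add _ _ hmem, Function.update_self, Function.update_of_ne hij.symm,
        ← hSc]
      congr 2
      exact Finset.sum_congr rfl fun k hk => by
        rw [Function.update_of_ne (Finset.ne_of_mem_erase hk)]
  · -- Only the `o`-th and the `j`-th terms are maximal, so the `o`-th dominates the others.
    obtain rfl : i = o := by
      by_contra hio
      exact hi ⟨i, hio, hij, heq⟩
    have hvi : v (t i : K) = v (t j : K) := by rw [← trop_eq_trop_iff, ht, ht, heq]
    refine ⟨t, hto, ht, ?_⟩
    rw [← Finset.add_sum_erase _ _ (Finset.mem_erase.2 ⟨hij, Finset.mem_univ i⟩), ← hvi]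
    refine v.map_add_eq_of_lt_left (v.map_lt_sum (v.ne_top_iff.2 (t i).ne_zero) fun k hk => ?_)
    simp only [Finset.mem_erase, Finset.mem_univ, and_true] at hk
    refine lt_of_le_of_ne (hvi ▸ htle k) fun h => hi ⟨k, hk.1, hk.2, ?_⟩
    rw [← ht, ← ht, trop_eq_trop_iff, ← h, hvi]

variable {P B : Type*} {G : IncidenceStructure P B} (D : G.Dehomogenization)

/-- A tropical curve through the tropicalization of `p` lifts to an algebraic curve through `p`
with the same normalized coefficient. -/
theorem exists_lift_curve (y : B)
    (c : {i : {i // i ∈ (D.exps y).1} // i ≠ D.base y} → valueGroup v) (p : Kˣ × Kˣ)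
    (h : (trop v p.1, trop v p.2) ∈ tropCurve (D.exps y).1 (D.coeffs 0 y c)) :
    ∃ c' : {i : {i // i ∈ (D.exps y).1} // i ≠ D.base y} → Kˣ,
      (fun k => trop v (c' k)) = c ∧ p ∈ algCurve (D.exps y).1 (D.coeffs 1 y c') := by
  let m : {i // i ∈ (D.exps y).1} → Kˣ := algMonomial 1 p
  have hmono : ∀ a k, algMonomial (I := (D.exps y).1) a p k = a k * m k := fun a k => by
    simp [m, algMonomial]
  have htrop : ∀ (a : _ → valueGroup v) k,
      tropMonomial (I := (D.exps y).1) a (trop v p.1, trop v p.2) k = a k + trop v (m k) :=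
    fun a k => by simp [m, trop_algMonomial, tropMonomial, trop_one]
  obtain ⟨t, hto, ht, hsum⟩ := exists_lift_sum_eq_zero v (o := D.base y) (z := m (D.base y))
    (tropMonomial (D.coeffs 0 y c) (trop v p.1, trop v p.2))
    (by simp [htrop, IncidenceStructure.Dehomogenization.coeffs]) h
  have hcoeff : D.coeffs 1 y (fun k => t k.1 / m k.1) = fun k => t k / m k := by
    funext k
    by_cases hk : k = D.base y
    · subst hk; simp [IncidenceStructure.Dehomogenization.coeffs, hto]
    · simp [IncidenceStructure.Dehomogenization.coeffs, hk]
  refine ⟨fun k => t k.1 / m k.1, ?_, ?_⟩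
  · funext k
    have h1 := trop_mul v (t k.1 / m k.1) (m k.1)
    rw [div_mul_cancel, ht, htrop] at h1
    rw [← add_right_cancel h1]
    simp [IncidenceStructure.Dehomogenization.coeffs, k.2]
  · rw [mem_algCurve_iff, hcoeff]
    simp only [hmono, div_mul_cancel]
    exact hsum

end LiftCurve

/-! ### Lifting a point to a given curve -/

section LiftPoint

/-- A finite set of exponents can be packed injectively into `ℕ` by an affine function whose
linear part is `i ↦ i₁ + N i₂`. -/
theorem exists_natCast_eq_add_mul_injOn (I : Finset (ℤ × ℤ)) :
    ∃ (M N : ℤ) (e : {i // i ∈ I} → ℕ), Function.Injective e ∧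
      ∀ i, (e i : ℤ) = M + (i.1.1 + N * i.1.2) := by
  obtain ⟨C, hC⟩ : ∃ C : ℤ, ∀ i ∈ I, |i.1| < C ∧ |i.2| < C := by
    refine ⟨∑ i ∈ I, (|i.1| + |i.2|) + 1, fun i hi => ?_⟩
    have := Finset.single_le_sum (f := fun i : ℤ × ℤ => |i.1| + |i.2|)
      (fun i _ => by positivity) hi
    constructor <;> linarith [abs_nonneg i.1, abs_nonneg i.2]
  have hnonneg : ∀ i : {i // i ∈ I}, 0 ≤ (C + 2 * C * C) + (i.1.1 + 2 * C * i.1.2) := fun i => by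
    obtain ⟨h1, h2⟩ := hC i.1 i.2
    rw [abs_lt] at h1 h2
    nlinarith
  refine ⟨C + 2 * C * C, 2 * C, fun i => (_ : ℤ).toNat, fun i j hij => ?_,
    fun i => Int.toNat_of_nonneg (hnonneg i)⟩
  have h : (i.1.1 - j.1.1) = 2 * C * (j.1.2 - i.1.2) := by
    have := congrArg (Nat.cast (R := ℤ)) hij
    simp only [Int.toNat_of_nonneg (hnonneg _)] at this
    linarith
  obtain ⟨hi1, -⟩ := hC i.1 i.2
  obtain ⟨hj1, -⟩ := hC j.1 j.2
  rw [abs_lt] at hi1 hj1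
  have h1 : i.1.1 - j.1.1 = 0 :=
    Int.eq_zero_of_abs_lt_dvd ⟨_, h⟩ (abs_lt.2 ⟨by linarith, by linarith⟩)
  have h2 : j.1.2 - i.1.2 = 0 := by
    rw [h1, eq_comm, mul_eq_zero] at h
    exact h.resolve_left (by linarith)
  exact Subtype.ext (Prod.ext (by linarith) (by linarith))

variable {K : Type*} [Field K] [IsAlgClosed K] (v : AddValuation K (WithTop ℝ))

/-- A point of a tropical plane curve lifts to any algebraic curve whose coefficients lift those
of the tropical curve. The lift is found on a one-parameter curve `r ↦ (q₁ r, q₂ r ^ N)`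
through an arbitrary lift `q` of the point, where `N` is so large that the monomials of the
equation restrict to distinct powers of `r`. -/
theorem exists_lift_point {I : Finset (ℤ × ℤ)} (a : {i // i ∈ I} → Kˣ)
    (p : valueGroup v × valueGroup v) (h : p ∈ tropCurve I fun k => trop v (a k)) :
    ∃ q : Kˣ × Kˣ, (trop v q.1, trop v q.2) = p ∧ q ∈ algCurve I a := by
  obtain ⟨q1, hq1⟩ := trop_surjective v p.1
  obtain ⟨q2, hq2⟩ := trop_surjective v p.2
  obtain rfl : (trop v q1, trop v q2) = p := Prod.ext hq1 hq2
  obtain ⟨i, j, hij, heq, hle⟩ := h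
  obtain ⟨M, N, e, he, heM⟩ := exists_natCast_eq_add_mul_injOn I
  let b : {i // i ∈ I} → Kˣ := algMonomial a (q1, q2)
  let f : Polynomial K := ∑ k, Polynomial.monomial (e k) (b k : K)
  have hcoeff : ∀ k, f.coeff (e k) = b k := fun k => by
    classical
    simp [f, Polynomial.coeff_monomial, he.eq_iff]
  have hcoeff0 : ∀ n, n ∉ Set.range e → f.coeff n = 0 := fun n hn => by
    simp only [f, Polynomial.finsetSum_coeff, Polynomial.coeff_monomial]
    exact Finset.sum_eq_zero fun k _ => if_neg fun hk => hn ⟨k, hk⟩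
  obtain ⟨r, hr, hvr⟩ : ∃ r, f.IsRoot r ∧ v r = 0 := by
    refine exists_isRoot_val_eq_zero v (he.ne hij) ?_ ?_ fun n => ?_
    · rw [hcoeff]; exact (b i).ne_zero
    · rw [hcoeff, hcoeff, ← trop_eq_trop_iff, trop_algMonomial, trop_algMonomial, heq]
    · by_cases hn : n ∈ Set.range e
      · obtain ⟨k, rfl⟩ := hn
        rw [hcoeff, hcoeff, ← trop_le_trop_iff, trop_algMonomial, trop_algMonomial]
        exact hle k
      · rw [hcoeff0 n hn, v.map_zero]; exact le_top
  have hr0 : r ≠ 0 := v.ne_top_iff.1 (by simp [hvr])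
  obtain ⟨r, rfl⟩ : ∃ u : Kˣ, (u : K) = r := ⟨Units.mk0 r hr0, rfl⟩
  have htr : trop v r = 0 := trop_eq_zero_of_val_eq_zero v hvr
  refine ⟨(q1 * r, q2 * r ^ N), by simp [trop_mul, trop_zpow, htr], mem_algCurve_iff.2 ?_⟩
  -- The factor `r ^ M` clears the negative exponents of `r`.
  have hmono : ∀ k, r ^ M * algMonomial a (q1 * r, q2 * r ^ N) k = b k * r ^ e k := fun k => by
    rw [← zpow_natCast, heM, zpow_add, zpow_add, zpow_mul]
    simp only [b, algMonomial, mul_zpow]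
    ext
    push_cast
    ring
  have hsum : (r ^ M : Kˣ) * ∑ k, (algMonomial a (q1 * r, q2 * r ^ N) k : K) = 0 := by
    rw [Finset.mul_sum, ← hr, Polynomial.eval_finsetSum]
    refine Finset.sum_congr rfl fun k _ => ?_
    rw [Polynomial.eval_monomial, ← Units.val_mul, hmono, Units.val_mul, Units.val_pow_eq_pow_val]
  exact (mul_eq_zero.1 hsum).resolve_left (Units.ne_zero _)

end LiftPoint

end TropicalIncidence

/-! ### Lifting realizations of acyclic incidence structures -/

open TropicalIncidence

theorem mainTheorem4 {K : Type*} [Field K] [IsAlgClosed K]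
    (v : AddValuation K (WithTop ℝ)) (hv : ∃ x : K, x ≠ 0 ∧ v x ≠ 0)
    {P B : Type*} [Finite P] [Finite B]
    (G : TropicalIncidence.IncidenceStructure P B) (hG : G.leviGraph.IsAcyclic)
    (D : G.Dehomogenization) :
    D.tropicalization v '' D.algRealizations K =
      D.tropRealizations (TropicalIncidence.valueGroup v) := by
  refine Set.Subset.antisymm ?_ fun s hs => ?_
  · rintro _ ⟨s, hs, rfl⟩ x y hxy
    have h := trop_mem_tropCurve v (D.exps y).2 (hs x y hxy)
    rwa [trop_coeffs] at h
  -- The admissible values at a vertex are the lifts of the tropical point or curve placed there.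
  let LP : P → Type _ := fun x => {q : Kˣ × Kˣ // (trop v q.1, trop v q.2) = s.1 x}
  let LB : B → Type _ := fun y =>
    {c : {i : {i // i ∈ (D.exps y).1} // i ≠ D.base y} → Kˣ // (fun k => trop v (c k)) = s.2 y}
  let X : P ⊕ B → Type _ := fun u => match u with
    | .inl x => LP x
    | .inr y => LB y
  have hX : ∀ u, Nonempty (X u) := by
    rintro (x | y)
    · obtain ⟨q1, h1⟩ := trop_surjective v (s.1 x).1
      obtain ⟨q2, h2⟩ := trop_surjective v (s.1 x).2
      exact ⟨⟨(q1, q2), Prod.ext h1 h2⟩⟩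
    · choose c hc using fun k => trop_surjective v (s.2 y k)
      exact ⟨⟨c, funext hc⟩⟩
  let L : ∀ x y, LP x → LB y → Prop := fun x y q c =>
    (x, y) ∈ G.flags → q.1 ∈ algCurve (D.exps y).1 (D.coeffs 1 y c.1)
  let R : ∀ u w, X u → X w → Prop := fun u w => match u, w with
    | .inl x, .inr y => fun q c => L x y q c
    | .inr y, .inl x => fun c q => L x y q c
    | .inl _, .inl _ => fun _ _ => True
    | .inr _, .inr _ => fun _ _ => True
  have hsymm : ∀ u w a b, R u w a b → R w u b a := by
    rintro (x | y) (x' | y') a b h <;> exact h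
  have hext : ∀ u w, G.leviGraph.Adj u w → ∀ a, ∃ b, R u w a b := by
    rintro (x | y) (x' | y') - a
    · exact ⟨Classical.choice (hX (.inl x')), trivial⟩
    · by_cases hxy : (x, y') ∈ G.flags
      · have h := hs x y' hxy
        rw [← a.2] at h
        obtain ⟨c, hc, hac⟩ := exists_lift_curve v D y' (s.2 y') a.1 h
        exact ⟨⟨c, hc⟩, fun _ => hac⟩
      · exact ⟨Classical.choice (hX (.inr y')), fun h => absurd h hxy⟩
    · by_cases hxy : (x', y) ∈ G.flags
      · have h := hs x' y hxy
        rw [← a.2, ← trop_coeffs] at h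
        obtain ⟨q, hq, hqa⟩ := exists_lift_point v _ _ h
        exact ⟨⟨q, hq⟩, fun _ => hqa⟩
      · exact ⟨Classical.choice (hX (.inl x')), fun h => absurd h hxy⟩
    · exact ⟨Classical.choice (hX (.inr y')), trivial⟩
  obtain ⟨f, hf⟩ := exists_forall_adj_of_isAcyclic hG R hsymm hext
  let fP : ∀ x, LP x := fun x => f (.inl x)
  let fB : ∀ y, LB y := fun y => f (.inr y)
  refine ⟨(fun x => (fP x).1, fun y => (fB y).1), fun x y hxy => ?_, ?_⟩
  · exact hf (.inl x) (.inr y) ((SimpleGraph.fromRel_adj _ _ _).2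
      ⟨Sum.inl_ne_inr, Or.inl ⟨x, y, rfl, rfl, hxy⟩⟩) hxy
  · exact Prod.ext (funext fun x => (fP x).2) (funext fun y => (fB y).2)
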